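/- Let $\mathcal X,\mathcal U,\mathcal Y$ be complex Hilbert spaces and let $\begin{bmatrix}A\&B\\ C\&D\end{bmatrix}$ be a system node on $(\mathcal X,\mathcal U,\mathcal Y)$. That is: $A\&B:\mathcal X\times\mathcal U\supset\operatorname{dom}(A\&B)\to\mathcal X$ is a closed linear operator; $C\&D:\operatorname{dom}(A\&B)\to\mathcal Y$ is linear and bounded with respect to the graph norm $$\Big\|\begin{pmatrix}x\\u\end{pmatrix}\Big\|_{\operatorname{dom}(A\&B)}=\Big(\|x\|_{\mathcal X}^2+\|u\|_{\mathcal U}^2+\Big\|A\&B\begin{pmatrix}x\\u\end{pmatrix}\Big\|_{\mathcal X}^2\Big)^{1/2};$$ for every $u\in\mathcal U$ there is some $x\in\mathcal X$ with $\begin{pmatrix}x\\u\end{pmatrix}\in\operatorname{dom}(A\&B)$; and the main operator $Ax=A\&B\begin{pmatrix}x\\0\end{pmatrix}$, with domain $\{x\in\mathcal X:\begin{pmatrix}x\\0\end{pmatrix}\in\operatorname{dom}(A\&B)\}$, generates a strongly continuous semigroup on $\mathcal X$. A classical trajectory on $[0,T]$ is a triple $(x,u,y)\in C^1([0,T];\mathcal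 X)\times C([0,T];\mathcal U)\times C([0,T];\mathcal Y)$ such that, for all $t\in[0,T]$, $\begin{pmatrix}x(t)\\u(t)\end{pmatrix}\in\operatorname{dom}(A\&B)$, $\dot x(t)=A\&B\begin{pmatrix}x(t)\\u(t)\end{pmatrix}$ and $y(t)=C\&D\begin{pmatrix}x(t)\\u(t)\end{pmatrix}$. Let $Q=Q^*\in L(\mathcal Y)$, $S\in L(\mathcal U,\mathcal Y)$, $R=R^*\in L(\mathcal U)$, and let $$s(y,u)=\Big\langle\begin{pmatrix}y\\u\end{pmatrix},\begin{bmatrix}Q&S\\S^*&R\end{bmatrix}\begin{pmatrix}y\\u\end{pmatrix}\Big\rangle_{\mathcal Y\times\mathcal U}.$$ Let $\mathcal S:\mathcal X\supset\operatorname{dom}(\mathcal S)\to\mathbb R$ be a semi-bounded, closed and densely defined real quadratic form, where these notions mean the following. The set $\operatorname{dom}(\mathcal S)$ is a dense linear subspace of $\mathcal X$, $\mathcal S(0)=0$, and $$h(x,z)=\tfrac14\big(\mathcal S(x+z)-\mathcal S(x-z)+i\,\mathcal S(x+iz)-i\,\mathcal S(x-iz)\big)$$ is a sesquilinear form on $\operatorname{dom}(\mathcal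 S)$. For some sign $\sigma\in\{1,-1\}$ and some $\lambda_0\ge0$, $x\mapsto(\sigma\mathcal S(x)+\lambda_0\|x\|_{\mathcal X}^2)^{1/2}$ is a norm on $\operatorname{dom}(\mathcal S)$ (semi-boundedness), and, for some such $\sigma$ and $\lambda_0$ and some $\lambda>\lambda_0$, $\operatorname{dom}(\mathcal S)$ is complete with respect to the norm $x\mapsto(\sigma\mathcal S(x)+\lambda\|x\|_{\mathcal X}^2)^{1/2}$ (closedness). Assume that the system is dissipative with respect to the supply rate functional $s$ and storage function $\mathcal S$: for every $T>0$ and every classical trajectory $(x,u,y)$ on $[0,T]$ one has $x(0),x(T)\in\operatorname{dom}(\mathcal S)$ and $$\mathcal S(x(T))-\mathcal S(x(0))+\int_0^Ts\big(y(t),u(t)\big)\,dt\ge0.$$ Let $\mathcal V=\{x\in\mathcal X:\exists\,u\in\mathcal U\text{ with }\begin{pmatrix}x\\u\end{pmatrix}\in\operatorname{dom}(A\&B)\}$, with the norm $$\|x\|_{\mathcal V}=\inf\Big\{\Big\|\begin{pmatrix}x\\u\end{pmatrix}\Big\|_{\operatorname{dom}(A\&B)}: u\in\mathcal U,\ \begin{pmatrix}x\\u\end{pmatrix}\in\operatorname{dom}(A\&B)\Big\}.$$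 Then $\mathcal V\subset\operatorname{dom}(\mathcal S)$, and there exists a constant $c>0$ such that $|\mathcal S(x_0)|\le c\,\|x_0\|_{\mathcal V}^2$ for all $x_0\in\mathcal V$. -/

import Mathlib

open Set Filter Topology
open scoped NNReal

noncomputable section

/-! ### Strongly continuous semigroups -/

/-- A strongly continuous semigroup of bounded linear operators on `X`. -/
structure C0Semigroup (X : Type*) [NormedAddCommGroup X] [NormedSpace ℂ X] where
  op : ℝ≥0 → X →L[ℂ] X
  op_zero : op 0 = ContinuousLinearMap.id ℂ X
  op_add : ∀ s t : ℝ≥0, op (s + t) = (op s).comp (op t)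
  continuous_orbit : ∀ x : X, Continuous fun t : ℝ≥0 => op t x

/-- The (unbounded) operator `A` is the generator of the semigroup `G`: we have `x ∈ dom A` and
`A x = z` if and only if `(G h x - x) / h` tends to `z` as `h ↓ 0`. In particular `dom A` is the
set of all `x` for which this limit exists. -/
def IsGenerator {X : Type*} [NormedAddCommGroup X] [NormedSpace ℂ X]
    (A : X →ₗ.[ℂ] X) (G : C0Semigroup X) : Prop :=
  ∀ x z : X, (∃ hx : x ∈ A.domain, A ⟨x, hx⟩ = z) ↔
    Tendsto (fun h : ℝ≥0 => ((h : ℝ)⁻¹ : ℂ) • (G.op h x - x)) (𝓝[>] 0) (𝓝 z)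

/-! ### System nodes and their classical trajectories -/

/-- The main operator of `A&B`: its domain is `{x | (x, 0) ∈ dom (A&B)}`, and `A x = A&B (x, 0)`. -/
def mainOperator {X U : Type*} [NormedAddCommGroup X] [NormedSpace ℂ X]
    [NormedAddCommGroup U] [NormedSpace ℂ U] (AB : X × U →ₗ.[ℂ] X) : X →ₗ.[ℂ] X where
  domain := AB.domain.comap (LinearMap.inl ℂ X U)
  toFun := AB.toFun ∘ₗ (LinearMap.inl ℂ X U).submoduleComap AB.domain

/-- The graph norm `(‖x‖² + ‖u‖² + ‖A&B (x, u)‖²)^(1/2)` of `(x, u) ∈ dom (A&B)`, where `X × U`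
carries the Hilbert space norm `(‖x‖² + ‖u‖²)^(1/2)`. -/
def graphNorm {X U : Type*} [NormedAddCommGroup X] [NormedSpace ℂ X]
    [NormedAddCommGroup U] [NormedSpace ℂ U] (AB : X × U →ₗ.[ℂ] X) (z : AB.domain) : ℝ :=
  √(‖(z : X × U).1‖ ^ 2 + ‖(z : X × U).2‖ ^ 2 + ‖AB z‖ ^ 2)

/-- A system node on the triple `(X, U, Y)`. -/
structure SystemNode (X U Y : Type*)
    [NormedAddCommGroup X] [InnerProductSpace ℂ X] [CompleteSpace X]
    [NormedAddCommGroup U] [InnerProductSpace ℂ U] [CompleteSpace U]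
    [NormedAddCommGroup Y] [InnerProductSpace ℂ Y] [CompleteSpace Y] where
  /-- the operator `A&B` with its domain -/
  AB : X × U →ₗ.[ℂ] X
  /-- the operator `C&D`, which has the same domain as `A&B` -/
  CD : AB.domain →ₗ[ℂ] Y
  closed_AB : AB.IsClosed
  bounded_CD : ∃ K : ℝ, ∀ z : AB.domain, ‖CD z‖ ≤ K * graphNorm AB z
  exists_state : ∀ u : U, ∃ x : X, (x, u) ∈ AB.domain
  generates : ∃ G : C0Semigroup X, IsGenerator (mainOperator AB) G

namespace SystemNode

variable {X U Y : Type*}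
  [NormedAddCommGroup X] [InnerProductSpace ℂ X] [CompleteSpace X]
  [NormedAddCommGroup U] [InnerProductSpace ℂ U] [CompleteSpace U]
  [NormedAddCommGroup Y] [InnerProductSpace ℂ Y] [CompleteSpace Y]

/-- `(x(·), u(·), y(·))` is a classical trajectory on `[0, T]` (only the values on `[0, T]` matter;
at the end points the derivative is one-sided). -/
structure IsClassicalTrajectory (N : SystemNode X U Y) (T : ℝ)
    (x : ℝ → X) (u : ℝ → U) (y : ℝ → Y) : Prop where
  contDiffOn_x : ContDiffOn ℝ 1 x (Icc 0 T)
  continuousOn_u : ContinuousOn u (Icc 0 T)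
  continuousOn_y : ContinuousOn y (Icc 0 T)
  eqn : ∀ t ∈ Icc (0 : ℝ) T, ∃ h : (x t, u t) ∈ N.AB.domain,
    HasDerivWithinAt x (N.AB ⟨(x t, u t), h⟩) (Icc 0 T) t ∧ y t = N.CD ⟨(x t, u t), h⟩

/-- The space `V` of all `x` for which there is some `u` with `(x, u) ∈ dom (A&B)`. -/
def V (N : SystemNode X U Y) : Set X :=
  {x | ∃ u : U, (x, u) ∈ N.AB.domain}

/-- The norm of `V`: the infimum of the graph norms of all `(x, u) ∈ dom (A&B)`. -/
def normV (N : SystemNode X U Y) (x : X) : ℝ :=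
  sInf {r : ℝ | ∃ (u : U) (h : (x, u) ∈ N.AB.domain), r = graphNorm N.AB ⟨(x, u), h⟩}

end SystemNode

/-! ### Supply rates -/

/-- The supply rate `s(y, u) = ⟨(y, u), (Q y + S u, S* y + R u)⟩` with the inner product of the
Hilbert space `Y × U`. For self-adjoint `Q` and `R` this number is real. -/
def supplyRate {U Y : Type*}
    [NormedAddCommGroup U] [InnerProductSpace ℂ U] [CompleteSpace U]
    [NormedAddCommGroup Y] [InnerProductSpace ℂ Y] [CompleteSpace Y]
    (Q : Y →L[ℂ] Y) (S : U →L[ℂ] Y) (R : U →L[ℂ] U) (y : Y) (u : U) : ℝ :=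
  (inner ℂ y (Q y + S u) + inner ℂ u (ContinuousLinearMap.adjoint S y + R u)).re

/-! ### Real quadratic forms -/

/-- The polarization
`h(x, z) = (S(x + z) - S(x - z) + i S(x + i z) - i S(x - i z)) / 4` of a real function `S`. -/
def polarization {D : Type*} [AddCommGroup D] [Module ℂ D] (S : D → ℝ) (x z : D) : ℂ :=
  (1 / 4 : ℂ) * ((S (x + z) : ℂ) - (S (x - z) : ℂ)
    + Complex.I * (S (x + Complex.I • z) : ℂ) - Complex.I * (S (x - Complex.I • z) : ℂ))

/-- A real quadratic form defined on a subspace of `X`: its polarization is a sesquilinear form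
(linear in the first argument, conjugate linear in the second one), and it vanishes at `0`. -/
structure RealQuadraticForm (X : Type*) [NormedAddCommGroup X] [NormedSpace ℂ X] where
  dom : Submodule ℂ X
  toFun : dom → ℝ
  map_zero : toFun 0 = 0
  polar_add_left : ∀ x x' z : dom,
    polarization toFun (x + x') z = polarization toFun x z + polarization toFun x' z
  polar_smul_left : ∀ (a : ℂ) (x z : dom),
    polarization toFun (a • x) z = a * polarization toFun x z
  polar_add_right : ∀ x z z' : dom,
    polarization toFun x (z + z') = polarization toFun x z + polarization toFun x z'
  polar_smul_right : ∀ (a : ℂ) (x z : dom),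
    polarization toFun x (a • z) = (starRingEnd ℂ) a * polarization toFun x z

namespace RealQuadraticForm

variable {X : Type*} [NormedAddCommGroup X] [NormedSpace ℂ X]

/-- The form is densely defined. -/
def IsDenselyDefined (S : RealQuadraticForm X) : Prop :=
  Dense (S.dom : Set X)

/-- The function `x ↦ (σ S(x) + lam ‖x‖²)^(1/2)` on the domain of the form. -/
def formNorm (S : RealQuadraticForm X) (σ lam : ℝ) (x : S.dom) : ℝ :=
  √(σ * S.toFun x + lam * ‖(x : X)‖ ^ 2)

/-- The function `x ↦ (σ S(x) + lam ‖x‖²)^(1/2)` is (well defined and) a norm on the domain. -/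
structure IsFormNorm (S : RealQuadraticForm X) (σ lam : ℝ) : Prop where
  radicand_nonneg : ∀ x : S.dom, 0 ≤ σ * S.toFun x + lam * ‖(x : X)‖ ^ 2
  eq_zero : ∀ x : S.dom, S.formNorm σ lam x = 0 → x = 0
  smul : ∀ (a : ℂ) (x : S.dom), S.formNorm σ lam (a • x) = ‖a‖ * S.formNorm σ lam x
  triangle : ∀ x z : S.dom, S.formNorm σ lam (x + z) ≤ S.formNorm σ lam x + S.formNorm σ lam z

/-- Every sequence in the domain that is Cauchy with respect to `(σ S(x) + lam ‖x‖²)^(1/2)`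
converges with respect to it to an element of the domain. -/
def IsFormComplete (S : RealQuadraticForm X) (σ lam : ℝ) : Prop :=
  ∀ f : ℕ → S.dom,
    (∀ ε > 0, ∃ n₀ : ℕ, ∀ m ≥ n₀, ∀ n ≥ n₀, S.formNorm σ lam (f m - f n) < ε) →
      ∃ x : S.dom, Tendsto (fun n => S.formNorm σ lam (f n - x)) atTop (𝓝 0)

/-- The form is semi-bounded. -/
def IsSemiBounded (S : RealQuadraticForm X) : Prop :=
  ∃ σ : ℝ, (σ = 1 ∨ σ = -1) ∧ ∃ lam : ℝ, 0 ≤ lam ∧ S.IsFormNorm σ lam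

/-- The (semi-bounded) form is closed: its domain is complete with respect to
`(σ S(x) + lam ‖x‖²)^(1/2)` for some `lam` that is strictly larger than an admissible one. As usual,
the strict inequality makes the norm dominate a multiple of the norm of `X`; up to equivalence the
norm then does not depend on `lam`. -/
def IsClosedForm (S : RealQuadraticForm X) : Prop :=
  ∃ σ : ℝ, (σ = 1 ∨ σ = -1) ∧ ∃ lam₀ : ℝ, 0 ≤ lam₀ ∧ S.IsFormNorm σ lam₀ ∧
    ∃ lam : ℝ, lam₀ < lam ∧ S.IsFormComplete σ lam

end RealQuadraticForm

/-! ### Dissipativity -/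

/-- The system given by the node `N` is dissipative with respect to the supply rate functional
`s` and storage function `S`: for every classical trajectory on `[0, T]`, `T > 0`, we have
`x(0), x(T) ∈ dom S` and the dissipation inequality holds. -/
def SystemNode.IsDissipative {X U Y : Type*}
    [NormedAddCommGroup X] [InnerProductSpace ℂ X] [CompleteSpace X]
    [NormedAddCommGroup U] [InnerProductSpace ℂ U] [CompleteSpace U]
    [NormedAddCommGroup Y] [InnerProductSpace ℂ Y] [CompleteSpace Y]
    (N : SystemNode X U Y) (s : Y → U → ℝ) (S : RealQuadraticForm X) : Prop :=
  ∀ T : ℝ, 0 < T → ∀ (x : ℝ → X) (u : ℝ → U) (y : ℝ → Y), N.IsClassicalTrajectory T x u y →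
    ∃ (h0 : x 0 ∈ S.dom) (hT : x T ∈ S.dom),
      0 ≤ S.toFun ⟨x T, hT⟩ - S.toFun ⟨x 0, h0⟩ + ∫ t in (0 : ℝ)..T, s (y t) (u t)

end

/-!
With the constant input `u₀`, the classical trajectory starting at `(x₀, u₀) ∈ dom (A&B)` has the
state `x t = x₀ + ∫ s in 0..t, G s z`, where `z = A&B (x₀, u₀)` and `G` is the semigroup generated
by the main operator. So every point of `V` is the initial state of a classical trajectory, and
dissipativity puts it into `dom S`.

The bound is the closed graph theorem. The projection `((x, u), A&B (x, u)) ↦ x` maps the graph of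
`A&B`, a Banach space, into `dom S`. Since `S` is closed, `dom S` with the form norm is a Banach
space continuously embedded into `X`, hence the projection is bounded for the form norm, and the
form norm controls `|S|`.
-/

namespace C0Semigroup

variable {X : Type*} [NormedAddCommGroup X] [NormedSpace ℂ X] (G : C0Semigroup X) (z : X)

/-- The orbit `t ↦ G t z`, extended to negative times by the constant `z` so that it can be
integrated over intervals of real numbers. -/
def extendedOrbit (t : ℝ) : X := G.op t.toNNReal z

theorem continuous_extendedOrbit : Continuous (G.extendedOrbit z) :=
  (G.continuous_orbit z).comp continuous_real_toNNReal

theorem extendedOrbit_zero : G.extendedOrbit z 0 = z := by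
  simp [extendedOrbit, G.op_zero]

theorem op_extendedOrbit (h : ℝ≥0) {t : ℝ} (ht : 0 ≤ t) :
    G.op h (G.extendedOrbit z t) = G.extendedOrbit z (t + h) := by
  simp only [extendedOrbit, Real.toNNReal_add ht h.coe_nonneg, Real.toNNReal_coe, add_comm _ h,
    G.op_add, ContinuousLinearMap.comp_apply]

/-- The integrated orbit `t ↦ ∫ s in 0..t, G s z`, the state reached from `0` under the constant
forcing term `z`. -/
noncomputable def orbitIntegral (t : ℝ) : X := ∫ s in (0 : ℝ)..t, G.extendedOrbit z s

theorem orbitIntegral_zero : G.orbitIntegral z 0 = 0 :=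
  intervalIntegral.integral_same

variable [CompleteSpace X]

theorem hasDerivAt_orbitIntegral (t : ℝ) :
    HasDerivAt (G.orbitIntegral z) (G.extendedOrbit z t) t :=
  ((G.continuous_extendedOrbit z).integral_hasStrictDerivAt 0 t).hasDerivAt

theorem contDiff_orbitIntegral : ContDiff ℝ 1 (G.orbitIntegral z) := by
  rw [contDiff_one_iff_deriv, funext fun t => (G.hasDerivAt_orbitIntegral z t).deriv]
  exact ⟨fun t => (G.hasDerivAt_orbitIntegral z t).differentiableAt, G.continuous_extendedOrbit z⟩

theorem op_orbitIntegral (h : ℝ≥0) {t : ℝ} (ht : 0 ≤ t) :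
    G.op h (G.orbitIntegral z t) = G.orbitIntegral z (t + h) - G.orbitIntegral z h := by
  have integrable (a b : ℝ) := (G.continuous_extendedOrbit z).intervalIntegrable a b
    (μ := MeasureTheory.volume)
  calc G.op h (G.orbitIntegral z t)
      = ∫ s in (0 : ℝ)..t, G.op h (G.extendedOrbit z s) :=
        (ContinuousLinearMap.intervalIntegral_comp_comm (G.op h) (integrable 0 t)).symm
    _ = ∫ s in (0 : ℝ)..t, G.extendedOrbit z (s + h) :=
        intervalIntegral.integral_congr fun s hs =>
          G.op_extendedOrbit z h (uIcc_of_le ht ▸ hs).1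
    _ = ∫ s in (h : ℝ)..t + h, G.extendedOrbit z s := by
        rw [intervalIntegral.integral_comp_add_right, zero_add]
    _ = G.orbitIntegral z (t + h) - G.orbitIntegral z h :=
        (intervalIntegral.integral_interval_sub_left (integrable _ _) (integrable _ _)).symm

end C0Semigroup

theorem IsGenerator.apply_orbitIntegral {X : Type*} [NormedAddCommGroup X] [NormedSpace ℂ X]
    [CompleteSpace X] {A : X →ₗ.[ℂ] X} {G : C0Semigroup X} (hA : IsGenerator A G) (z : X)
    {t : ℝ} (ht : 0 ≤ t) :
    ∃ h : G.orbitIntegral z t ∈ A.domain,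
      A ⟨G.orbitIntegral z t, h⟩ = G.extendedOrbit z t - z := by
  rw [hA]
  have coe_tendsto : Tendsto ((↑) : ℝ≥0 → ℝ) (𝓝[>] 0) (𝓝[>] 0) :=
    NNReal.continuous_coe.continuousWithinAt.tendsto_nhdsWithin fun _ => NNReal.coe_pos.2
  have slope_tendsto (s : ℝ) :=
    (G.hasDerivAt_orbitIntegral z s).tendsto_slope_zero_right.comp coe_tendsto
  have slope_sub_tendsto := (slope_tendsto t).sub (slope_tendsto 0)
  rw [G.extendedOrbit_zero] at slope_sub_tendsto
  refine slope_sub_tendsto.congr fun h => ?_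
  simp only [Function.comp_apply, zero_add, G.orbitIntegral_zero, sub_zero,
    G.op_orbitIntegral z h ht]
  rw [← smul_sub, ← Complex.ofReal_inv, Complex.coe_smul, sub_right_comm]

section SystemOperator

variable {X U : Type*} [NormedAddCommGroup X] [NormedSpace ℂ X]
  [NormedAddCommGroup U] [NormedSpace ℂ U] {AB : X × U →ₗ.[ℂ] X}

theorem mainOperator.apply_add_left {x w : X} {u : U} (h : (x, u) ∈ AB.domain)
    (hw : w ∈ (mainOperator AB).domain) :
    ∃ h' : (x + w, u) ∈ AB.domain,
      AB ⟨(x + w, u), h'⟩ = AB ⟨(x, u), h⟩ + mainOperator AB ⟨w, hw⟩ := by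
  have sum_eq : (x, u) + (w, (0 : U)) = (x + w, u) := by simp
  refine ⟨sum_eq ▸ AB.domain.add_mem h hw, ?_⟩
  exact (congrArg AB (Subtype.ext sum_eq.symm)).trans (AB.map_add ⟨(x, u), h⟩ ⟨(w, 0), hw⟩)

theorem IsGenerator.apply_add_orbitIntegral [CompleteSpace X] {G : C0Semigroup X}
    (hG : IsGenerator (mainOperator AB) G) {x : X} {u : U} (h : (x, u) ∈ AB.domain)
    {t : ℝ} (ht : 0 ≤ t) :
    ∃ h' : (x + G.orbitIntegral (AB ⟨(x, u), h⟩) t, u) ∈ AB.domain,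
      AB ⟨(x + G.orbitIntegral (AB ⟨(x, u), h⟩) t, u), h'⟩ =
        G.extendedOrbit (AB ⟨(x, u), h⟩) t := by
  obtain ⟨hw, apply_eq⟩ := hG.apply_orbitIntegral (AB ⟨(x, u), h⟩) ht
  obtain ⟨h', apply_add⟩ := mainOperator.apply_add_left h hw
  exact ⟨h', by rw [apply_add, apply_eq, add_sub_cancel]⟩

theorem norm_le_graphNorm (z : AB.domain) : ‖((z : X × U), AB z)‖ ≤ graphNorm AB z := by
  refine max_le (max_le ?_ ?_) ?_ <;> refine Real.le_sqrt_of_sq_le ?_ <;>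
    nlinarith [sq_nonneg ‖(z : X × U).1‖, sq_nonneg ‖(z : X × U).2‖, sq_nonneg ‖AB z‖]

end SystemOperator

namespace SystemNode

variable {X U Y : Type*}
  [NormedAddCommGroup X] [InnerProductSpace ℂ X] [CompleteSpace X]
  [NormedAddCommGroup U] [InnerProductSpace ℂ U] [CompleteSpace U]
  [NormedAddCommGroup Y] [InnerProductSpace ℂ Y] [CompleteSpace Y]
  (N : SystemNode X U Y)

theorem continuous_CD_comp {α : Type*} [TopologicalSpace α] {f : α → N.AB.domain}
    (hf : Continuous fun t => (f t : X × U)) (hAB : Continuous fun t => N.AB (f t)) :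
    Continuous fun t => N.CD (f t) := by
  obtain ⟨K, hK⟩ := N.bounded_CD
  refine continuous_iff_continuousAt.2 fun t => tendsto_iff_norm_sub_tendsto_zero.2 ?_
  have graphNorm_sub_continuous : Continuous fun s => K * graphNorm N.AB (f s - f t) := by
    simp only [graphNorm, Submodule.coe_sub, Prod.fst_sub, Prod.snd_sub, N.AB.map_sub]
    fun_prop
  have graphNorm_sub_tendsto := graphNorm_sub_continuous.tendsto' t 0 (by simp [graphNorm])
  exact squeeze_zero (fun _ => norm_nonneg _) (fun s => map_sub N.CD (f s) (f t) ▸ hK _)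
    graphNorm_sub_tendsto

theorem exists_isClassicalTrajectory {x₀ : X} {u₀ : U} (h₀ : (x₀, u₀) ∈ N.AB.domain) (T : ℝ) :
    ∃ (x : ℝ → X) (y : ℝ → Y), N.IsClassicalTrajectory T x (fun _ => u₀) y ∧ x 0 = x₀ := by
  obtain ⟨G, hG⟩ := N.generates
  let z := N.AB ⟨(x₀, u₀), h₀⟩
  let x (t : ℝ) : X := x₀ + G.orbitIntegral z t
  have x_contDiff : ContDiff ℝ 1 x := contDiff_const.add (G.contDiff_orbitIntegral z)
  choose mem_domain AB_eq using fun t : ℝ≥0 => hG.apply_add_orbitIntegral h₀ t.coe_nonneg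
  let f (t : ℝ≥0) : N.AB.domain := ⟨(x t, u₀), mem_domain t⟩
  have f_continuous : Continuous fun t => (f t : X × U) :=
    (x_contDiff.continuous.comp NNReal.continuous_coe).prodMk continuous_const
  have AB_f_continuous : Continuous fun t => N.AB (f t) :=
    ((G.continuous_extendedOrbit z).comp NNReal.continuous_coe).congr fun t => (AB_eq t).symm
  refine ⟨x, fun t => N.CD (f t.toNNReal), ⟨x_contDiff.contDiffOn, continuousOn_const, ?_, ?_⟩, ?_⟩
  · exact ((N.continuous_CD_comp f_continuous AB_f_continuous).comp
      continuous_real_toNNReal).continuousOn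
  · rintro t ⟨ht, -⟩
    lift t to ℝ≥0 using ht
    refine ⟨mem_domain t, ?_, by rw [Real.toNNReal_coe]⟩
    exact AB_eq t ▸ ((G.hasDerivAt_orbitIntegral z t).const_add x₀).hasDerivWithinAt
  · simp only [x, G.orbitIntegral_zero, add_zero]

variable {N}

theorem le_normV_sq {x : X} (hx : x ∈ N.V) {a : ℝ}
    (h : ∀ (u : U) (hu : (x, u) ∈ N.AB.domain), a ≤ graphNorm N.AB ⟨(x, u), hu⟩ ^ 2) :
    a ≤ N.normV x ^ 2 := by
  have sqrt_le : √a ≤ N.normV x := by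
    obtain ⟨u₀, h₀⟩ := id hx
    refine le_csInf ⟨_, u₀, h₀, rfl⟩ ?_
    rintro _ ⟨u, hu, rfl⟩
    exact Real.sqrt_le_iff.2 ⟨Real.sqrt_nonneg _, h u hu⟩
  exact (Real.sqrt_le_left ((Real.sqrt_nonneg a).trans sqrt_le)).1 sqrt_le

end SystemNode

namespace RealQuadraticForm

variable {X : Type*} [NormedAddCommGroup X] [NormedSpace ℂ X]
  {S : RealQuadraticForm X} {σ lam lam' : ℝ}

theorem formNorm_zero (S : RealQuadraticForm X) (σ lam : ℝ) : S.formNorm σ lam 0 = 0 := by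
  simp [formNorm, S.map_zero]

namespace IsFormNorm

theorem sq_formNorm (h : S.IsFormNorm σ lam) (x : S.dom) :
    S.formNorm σ lam x ^ 2 = σ * S.toFun x + lam * ‖(x : X)‖ ^ 2 :=
  Real.sq_sqrt (h.radicand_nonneg x)

theorem formNorm_eq_sqrt (h : S.IsFormNorm σ lam) (hl : lam ≤ lam') (x : S.dom) :
    S.formNorm σ lam' x = √(S.formNorm σ lam x ^ 2 + (√(lam' - lam) * ‖(x : X)‖) ^ 2) := by
  rw [h.sq_formNorm, mul_pow, Real.sq_sqrt (sub_nonneg.2 hl), formNorm]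
  congr 1
  ring

theorem mono (h : S.IsFormNorm σ lam) (hl : lam ≤ lam') : S.IsFormNorm σ lam' where
  radicand_nonneg x := (h.radicand_nonneg x).trans (by gcongr)
  eq_zero x hx := by
    have formNorm_le : S.formNorm σ lam x ≤ S.formNorm σ lam' x := by
      unfold formNorm
      gcongr
    exact h.eq_zero x (le_antisymm (formNorm_le.trans_eq hx) (Real.sqrt_nonneg _))
  smul a x := by
    have factor : S.formNorm σ lam (a • x) ^ 2 + (√(lam' - lam) * ‖((a • x : S.dom) : X)‖) ^ 2 =
        ‖a‖ ^ 2 * (S.formNorm σ lam x ^ 2 + (√(lam' - lam) * ‖(x : X)‖) ^ 2) := by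
      rw [h.smul, S.dom.coe_smul, norm_smul]
      ring
    rw [h.formNorm_eq_sqrt hl, h.formNorm_eq_sqrt hl, factor, Real.sqrt_mul (sq_nonneg _),
      Real.sqrt_sq (norm_nonneg a)]
  triangle x z := by
    have minkowski (a b c d : ℝ) :
        √((a + c) ^ 2 + (b + d) ^ 2) ≤ √(a ^ 2 + b ^ 2) + √(c ^ 2 + d ^ 2) := by
      simpa only [Complex.norm_eq_sqrt_sq_add_sq, Complex.add_re, Complex.add_im]
        using norm_add_le (⟨a, b⟩ : ℂ) ⟨c, d⟩
    simp only [h.formNorm_eq_sqrt hl]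
    refine le_trans ?_ (minkowski _ _ _ _)
    rw [← mul_add]
    gcongr
    · exact Real.sqrt_nonneg _
    · exact h.triangle x z
    · exact norm_add_le (x : X) z

theorem norm_le (h : S.IsFormNorm σ lam) (hl : lam < lam') (x : S.dom) :
    ‖(x : X)‖ ≤ (√(lam' - lam))⁻¹ * S.formNorm σ lam' x := by
  rw [inv_mul_eq_div, le_div_iff₀' (Real.sqrt_pos.2 (sub_pos.2 hl)), h.formNorm_eq_sqrt hl.le]
  exact Real.le_sqrt_of_sq_le (le_add_of_nonneg_left (sq_nonneg _))

theorem abs_toFun_le (h : S.IsFormNorm σ lam) (hσ : σ = 1 ∨ σ = -1) (hlam : 0 ≤ lam)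
    (x : S.dom) : |S.toFun x| ≤ S.formNorm σ lam x ^ 2 + lam * ‖(x : X)‖ ^ 2 := by
  have abs_σ : |σ| = 1 := by rcases hσ with rfl | rfl <;> simp
  calc |S.toFun x| = |S.formNorm σ lam x ^ 2 - lam * ‖(x : X)‖ ^ 2| := by
        rw [h.sq_formNorm, add_sub_cancel_right, abs_mul, abs_σ, one_mul]
    _ ≤ |S.formNorm σ lam x ^ 2| + |lam * ‖(x : X)‖ ^ 2| := abs_sub _ _
    _ = S.formNorm σ lam x ^ 2 + lam * ‖(x : X)‖ ^ 2 := by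
        rw [abs_of_nonneg (by positivity), abs_of_nonneg (by positivity)]

end IsFormNorm

/-- The domain of a form, normed by the form norm. This is a type synonym of `S.dom`, which already
carries the norm of `X`. -/
def FormSpace (_ : S.IsFormNorm σ lam) : Type _ := S.dom

namespace FormSpace

variable (h : S.IsFormNorm σ lam)

instance : AddCommGroup (FormSpace h) := inferInstanceAs (AddCommGroup S.dom)

instance : Module ℂ (FormSpace h) := inferInstanceAs (Module ℂ S.dom)

noncomputable instance : Norm (FormSpace h) := ⟨S.formNorm σ lam⟩

theorem normedSpaceCore : NormedSpace.Core ℂ (FormSpace h) where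
  norm_nonneg _ := Real.sqrt_nonneg _
  norm_smul := h.smul
  norm_triangle := h.triangle
  norm_eq_zero_iff x := by
    refine ⟨h.eq_zero x, ?_⟩
    rintro rfl
    exact S.formNorm_zero σ lam

noncomputable instance : NormedAddCommGroup (FormSpace h) := .ofCore (normedSpaceCore h)

noncomputable instance : NormedSpace ℂ (FormSpace h) := .ofCore (normedSpaceCore h)

theorem completeSpace (hc : S.IsFormComplete σ lam) : CompleteSpace (FormSpace h) := by
  refine Metric.complete_of_cauchySeq_tendsto fun f hf => ?_
  obtain ⟨x, hx⟩ := hc f fun ε hε => by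
    obtain ⟨n₀, hn₀⟩ := Metric.cauchySeq_iff.1 hf ε hε
    exact ⟨n₀, fun m hm n hn => (dist_eq_norm (f m) (f n)).symm.trans_lt (hn₀ m hm n hn)⟩
  exact ⟨x, tendsto_iff_norm_sub_tendsto_zero.2 hx⟩

/-- The inclusion of the domain of a form, normed by the form norm, into the ambient space. -/
def inclusion : FormSpace h →ₗ[ℂ] X := S.dom.subtype

theorem continuous_inclusion {lam₀ : ℝ} (h₀ : S.IsFormNorm σ lam₀) (hl : lam₀ < lam) :
    Continuous (inclusion h) :=
  AddMonoidHomClass.continuous_of_bound (inclusion h) _ (h₀.norm_le hl)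

variable {E : Type*} [NormedAddCommGroup E] [NormedSpace ℂ E]

/-- A linear map with values in the domain of a form, as a map into that domain with the form
norm. -/
def codRestrict (f : E →ₗ[ℂ] X) (hf : ∀ e, f e ∈ S.dom) : E →ₗ[ℂ] FormSpace h :=
  f.codRestrict S.dom hf

theorem continuous_codRestrict [CompleteSpace (FormSpace h)] [CompleteSpace E]
    (hi : Continuous (inclusion h)) (f : E →L[ℂ] X) (hf : ∀ e, f e ∈ S.dom) :
    Continuous (codRestrict h f.toLinearMap hf) := by
  refine LinearMap.continuous_of_seq_closed_graph _ fun u e y hu hy => Subtype.ext ?_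
  exact tendsto_nhds_unique ((hi.tendsto y).comp hy) ((f.continuous.tendsto e).comp hu)

end FormSpace

theorem IsClosedForm.exists_abs_toFun_le (hS : S.IsClosedForm)
    {E : Type*} [NormedAddCommGroup E] [NormedSpace ℂ E] [CompleteSpace E]
    (f : E →L[ℂ] X) (hf : ∀ e, f e ∈ S.dom) :
    ∃ c : ℝ, 0 < c ∧ ∀ e, |S.toFun ⟨f e, hf e⟩| ≤ c * ‖e‖ ^ 2 := by
  obtain ⟨σ, hσ, lam₀, hlam₀, h₀, lam, hl, hc⟩ := hS
  have hlam : 0 ≤ lam := hlam₀.trans hl.le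
  have h := h₀.mono hl.le
  have := FormSpace.completeSpace h hc
  have codRestrict_continuous :=
    FormSpace.continuous_codRestrict h (FormSpace.continuous_inclusion h h₀ hl) f hf
  obtain ⟨C, hC, bound⟩ := ContinuousLinearMap.bound ⟨_, codRestrict_continuous⟩
  refine ⟨C ^ 2 + lam * ‖f‖ ^ 2, by positivity, fun e => ?_⟩
  have formNorm_le : S.formNorm σ lam ⟨f e, hf e⟩ ≤ C * ‖e‖ := bound e
  calc |S.toFun ⟨f e, hf e⟩|
      ≤ S.formNorm σ lam ⟨f e, hf e⟩ ^ 2 + lam * ‖f e‖ ^ 2 :=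
        h.abs_toFun_le hσ hlam _
    _ ≤ (C * ‖e‖) ^ 2 + lam * (‖f‖ * ‖e‖) ^ 2 := by
        gcongr
        · exact Real.sqrt_nonneg _
        · exact f.le_opNorm e
    _ = (C ^ 2 + lam * ‖f‖ ^ 2) * ‖e‖ ^ 2 := by ring

theorem IsClosedForm.exists_abs_toFun_le_graphNorm (hS : S.IsClosedForm) [CompleteSpace X]
    {U : Type*} [NormedAddCommGroup U] [NormedSpace ℂ U] [CompleteSpace U]
    {AB : X × U →ₗ.[ℂ] X} (hAB : AB.IsClosed) (hdom : ∀ z : AB.domain, (z : X × U).1 ∈ S.dom) :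
    ∃ c : ℝ, 0 < c ∧ ∀ z : AB.domain,
      |S.toFun ⟨(z : X × U).1, hdom z⟩| ≤ c * graphNorm AB z ^ 2 := by
  have : CompleteSpace AB.graph := hAB.isComplete.completeSpace_coe
  let stateProj : AB.graph →L[ℂ] X :=
    (ContinuousLinearMap.fst ℂ X U ∘L ContinuousLinearMap.fst ℂ (X × U) X) ∘L AB.graph.subtypeL
  obtain ⟨c, hc, bound⟩ := hS.exists_abs_toFun_le stateProj fun w =>
    hdom ⟨w.1.1, AB.mem_domain_of_mem_graph w.2⟩
  refine ⟨c, hc, fun z => (bound ⟨_, AB.mem_graph z⟩).trans ?_⟩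
  gcongr
  exact norm_le_graphNorm z

end RealQuadraticForm

theorem proposition3p2_general {X U Y : Type*}
    [NormedAddCommGroup X] [InnerProductSpace ℂ X] [CompleteSpace X]
    [NormedAddCommGroup U] [InnerProductSpace ℂ U] [CompleteSpace U]
    [NormedAddCommGroup Y] [InnerProductSpace ℂ Y] [CompleteSpace Y]
    (N : SystemNode X U Y) (𝒮 : RealQuadraticForm X) (hclosed : 𝒮.IsClosedForm) (T : ℝ)
    (hinit : ∀ (x : ℝ → X) (u : ℝ → U) (y : ℝ → Y), N.IsClassicalTrajectory T x u y →
      x 0 ∈ 𝒮.dom) :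
    ∃ hV : ∀ x ∈ N.V, x ∈ 𝒮.dom,
      ∃ c : ℝ, 0 < c ∧ ∀ (x₀ : X) (hx₀ : x₀ ∈ N.V),
        |𝒮.toFun ⟨x₀, hV x₀ hx₀⟩| ≤ c * N.normV x₀ ^ 2 := by
  have hV : ∀ x ∈ N.V, x ∈ 𝒮.dom := by
    rintro x₀ ⟨u₀, h₀⟩
    obtain ⟨x, y, htraj, rfl⟩ := N.exists_isClassicalTrajectory h₀ T
    exact hinit x _ y htraj
  obtain ⟨c, hc, bound⟩ := hclosed.exists_abs_toFun_le_graphNorm N.closed_AB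
    fun z => hV _ ⟨_, z.2⟩
  refine ⟨hV, c, hc, fun x₀ hx₀ => ?_⟩
  rw [← div_le_iff₀' hc]
  exact SystemNode.le_normV_sq hx₀ fun u hu => (div_le_iff₀' hc).2 (bound ⟨(x₀, u), hu⟩)

theorem proposition3p2 {X U Y : Type*}
    [NormedAddCommGroup X] [InnerProductSpace ℂ X] [CompleteSpace X]
    [NormedAddCommGroup U] [InnerProductSpace ℂ U] [CompleteSpace U]
    [NormedAddCommGroup Y] [InnerProductSpace ℂ Y] [CompleteSpace Y]
    (N : SystemNode X U Y)
    (Q : Y →L[ℂ] Y) (S : U →L[ℂ] Y) (R : U →L[ℂ] U)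
    (hQ : IsSelfAdjoint Q) (hR : IsSelfAdjoint R)
    (𝒮 : RealQuadraticForm X)
    (hsemi : 𝒮.IsSemiBounded) (hclosed : 𝒮.IsClosedForm) (hdense : 𝒮.IsDenselyDefined)
    (hdiss : N.IsDissipative (supplyRate Q S R) 𝒮) :
    ∃ hV : ∀ x ∈ N.V, x ∈ 𝒮.dom,
      ∃ c : ℝ, 0 < c ∧ ∀ (x₀ : X) (hx₀ : x₀ ∈ N.V),
        |𝒮.toFun ⟨x₀, hV x₀ hx₀⟩| ≤ c * N.normV x₀ ^ 2 :=
  proposition3p2_general N 𝒮 hclosed 1 fun x u y htraj => (hdiss 1 one_pos x u y htraj).1
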